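/- **Setting.** Let $P^r$ (trial, RCT) and $P^o$ (observational study, OS) be probability laws of a unit $(U,Z,V,A,Y(1),Y(-1))$ with covariates $U\in\mathbb R^{p_u}$, $Z\in\mathbb R^{p_z}$, $V\in\mathbb R^{p_v}$, treatment $A\in\{-1,1\}$ and potential outcomes $Y(\pm1)$. Put $Y=Y(A)$ (SUTVA), $X^r=(U,Z)$, $X=(U,Z,V)$. Assume $Y(\pm 1)\in L_2(P^r)$ and $Y\in L_2(P^o)$. Let $\pi_a(x^r)=P^r(A=a\mid X^r=x^r)$, $\tau^r(x^r)=E_{P^r}[Y(1)-Y(-1)\mid X^r=x^r]$, $\mu^s_a(x)=E_{P^s}[Y\mid X=x,A=a]$ for $s\in\{r,o\}$, $\tilde\mu^r_a(x^r)=E_{P^r}[\mu^r_a(X)\mid X^r=x^r]$, and $\|f\|^2=E_{P^r}[f(X^r)^2]$. The data are i.i.d. samples of sizes $n^r\ge1$ and $n^o\ge1$ from $P^r$ and $P^o$, independent of each other. **Classes.** For $a=\pm1$ let $\mathcal M_a$ (functions of $z$; the class $\mathcal M^{o,\mathrm{sh}}_a$), $\mathcal D^{\mathrm{sh}}_a$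 and $\mathcal D$ (functions of $x^r$) be subsets of $L_2(P^r)$, with $0\in\mathcal D$. For a class $\mathcal H$ and sample points $x_1,\dots,x_n$ let $\mathfrak R_n(\mathcal H)=E_\epsilon\sup_{h\in\mathcal H}\frac1n\sum_i\epsilon_ih(x_i)\in[0,\infty]$ be its empirical Rademacher complexity ($\epsilon_i$ independent uniform signs), computed at the OS points $Z_i$ for $\mathcal M_a$ ($n=n^o$) and at the trial points $X^r_i$ for $\mathcal D^{\mathrm{sh}}_a$ and $\mathcal D$ ($n=n^r$). Put $\Delta_2^2(\mathcal D,\tau^r)=\inf_{d\in\mathcal D}\|d-\tau^r\|^2$ and $$B_{\mathrm{sh}}^2=\sum_{a=\pm1}\inf_{m\in\mathcal M_a,\,d\in\mathcal D^{\mathrm{sh}}_a}\|m(Z)+d-\tilde\mu^r_a\|^2 .$$ **Estimator (SR-OSCAR with $q\ge2$ cross-fitting folds).** Both samples are divided into folds $1,\dots,q$. For each fold $k$ and arm $a$, $\hat\mu^{(-k)}_a\in\mathcal M_a$ minimizes over $m\in\mathcal M_a$ the average of $(Y_i-m(Z_i))^2$ over the OS units of arm $a$ outside fold $k$ plus a penalty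 of $m$; and $\hat\delta^{(-k)}_a\in\mathcal D^{\mathrm{sh}}_a$ minimizes over $d\in\mathcal D^{\mathrm{sh}}_a$ the average of $(Y_i-\hat\mu^{(-k)}_a(Z_i)-d(X^r_i))^2$ over the trial units of arm $a$ outside fold $k$ plus a penalty of $d$. Let $\hat m^{(-k)}_a(x^r)=\hat\mu^{(-k)}_a(z)+\hat\delta^{(-k)}_a(x^r)$, $\hat m^{(-k)}=\sum_a\pi_{-a}\hat m^{(-k)}_a$, $\tilde\tau^{(-k)}=\sum_a a\,\hat m^{(-k)}_a$ and $\hat\psi^{(-k)}=A\{Y-\hat m^{(-k)}(X^r)\}/\pi_A(X^r)$. With $k(i)$ the fold of trial unit $i$, $\hat\delta\in\mathcal D$ minimizes over $d\in\mathcal D$ $$\frac1{n^r}\sum_{i}\bigl\{\hat\psi_i^{(-k(i))}-\tilde\tau^{(-k(i))}(X_i^r)-d(X_i^r)\bigr\}^2+\text{a penalty of }d .$$ The estimator is $\hat\tau_{\mathrm{SR}}=\sum_kw_k\tilde\tau^{(-k)}+\hat\delta$, where $w_k$ is the proportion of trial units in fold $k$. The penalties are arbitrary real-valued functions, and $\Delta_2^2(\hat\tau_{\mathrm{SR}},\tau^r)=\|\hat\tau_{\mathrm{SR}}-\tau^r\|^2$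 with the fitted function held fixed. **Assumptions.** 1. *Internal validity.* Under $P^r$: $(Y(1),Y(-1))\perp A\mid X^r$; the baseline block satisfies $V\perp A\mid X^r$; and for some $\rho>0$, $\rho\le\pi_a(X^r)\le1-\rho$ almost surely for both $a$. 2. *Outcome shift.* $\mu^r_a=\mu^o_a+\delta_a$, with $\delta_a$ in a class whose empirical Rademacher complexity on the trial sample is almost surely finite. 3. *Lipschitzness.* For some $L>0$, $\mu^r_a$, $\mu^o_a$ and $\delta_a$ are $L$-Lipschitz in $v$ for every fixed $x^r$ and $a$. 4. *Rates, with constant $\kappa>0$.* For every $\varepsilon>0$ there are oracle elements $m^\star_a\in\mathcal M_a$, $d^\star_a\in\mathcal D^{\mathrm{sh}}_a$ whose sum attains the $a$-th infimum in $B^2_{\mathrm{sh}}$ up to $\varepsilon$, such that for every $\gamma\in(0,1)$, with probability at least $1-\gamma$, for all $k$ and $a$ simultaneously: $$\|\hat\mu_a^{(-k)}-m_a^\star\|^2\le\kappa\bigl(\mathfrak R^2_{n^o}(\mathcal M_a)+t\bigr),\quad \|\hat\delta_a^{(-k)}-d_a^\star\|^2\le\kappa\bigl(\mathfrak R^2_{n^r}(\mathcal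 D^{\mathrm{sh}}_a)+t\bigr),\quad \|\hat\delta-\delta^\star\|^2\le\kappa\bigl(\mathfrak R^2_{n^r}(\mathcal D)+t\bigr),$$ where $t=\log(1/\gamma)/n^r$ and $\delta^\star\in\mathcal D$ is some minimizer, up to $\varepsilon$, over $d\in\mathcal D$ of the population second-stage risk $\sum_kw_kE_{P^r}\{\hat\psi^{(-k)}-\tilde\tau^{(-k)}(X^r)-d(X^r)\}^2$ (the fitted functions being held fixed). **Theorem (Risk bound for SR-OSCAR).** For every $\kappa>0$ there is a constant $C>0$, depending only on $\kappa$, such that in every setting as above and for every $\gamma\in(0,1)$, with probability at least $1-\gamma$ over the data, $$\Delta_2^2(\hat\tau_{\mathrm{SR}},\tau^r)\le\Delta_2^2(\mathcal D,\tau^r)+C\Bigl[B_{\mathrm{sh}}^2+\mathfrak R_{n^r}^2(\mathcal D)+\sum_{a=\pm1}\bigl(\mathfrak R_{n^o}^2(\mathcal M_a)+\mathfrak R_{n^r}^2(\mathcal D^{\mathrm{sh}}_a)\bigr)\Bigr]+C\,\frac{\log(1/\gamma)}{n^r}.$$ -/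

import Mathlib

open MeasureTheory ProbabilityTheory
open scoped ENNReal

noncomputable section

namespace SROscar

/-! ### Units, covariate blocks, treatments and outcomes -/

/-- Treatment arms: `true` is the arm `1` and `false` is the arm `-1`. -/
abbrev Arm := Bool

/-- The numerical value `1` or `-1` of an arm (also used for Rademacher signs). -/
def sgn (a : Bool) : ℝ := if a then 1 else -1

/-- Covariates recorded in the trial, `Xr = (U, Z)`. -/
abbrev RctCov (pu pz : ℕ) := EuclideanSpace ℝ (Fin pu) × EuclideanSpace ℝ (Fin pz)

/-- The complete covariate vector, `X = (Xr, V) = ((U, Z), V)`. -/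
abbrev FullCov (pu pz pv : ℕ) := RctCov pu pz × EuclideanSpace ℝ (Fin pv)

/-- A unit: its complete covariate vector, its treatment and its two potential outcomes. -/
abbrev Subject (pu pz pv : ℕ) := FullCov pu pz pv × Arm × (Arm → ℝ)

section Coordinates

variable {pu pz pv : ℕ}

def full (s : Subject pu pz pv) : FullCov pu pz pv := s.1

def xr (s : Subject pu pz pv) : RctCov pu pz := s.1.1

def shared (s : Subject pu pz pv) : EuclideanSpace ℝ (Fin pz) := s.1.1.2

def osOnly (s : Subject pu pz pv) : EuclideanSpace ℝ (Fin pv) := s.1.2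

def arm (s : Subject pu pz pv) : Arm := s.2.1

def potential (s : Subject pu pz pv) : Arm → ℝ := s.2.2

/-- The observed outcome is the potential outcome of the received treatment (SUTVA). -/
def outcome (s : Subject pu pz pv) : ℝ := potential s (arm s)

lemma measurable_xr : Measurable (xr : Subject pu pz pv → RctCov pu pz) :=
  measurable_fst.comp measurable_fst

/-- The sigma-algebra generated by the trial covariates. -/
abbrev sigmaXr (pu pz pv : ℕ) : MeasurableSpace (Subject pu pz pv) :=
  MeasurableSpace.comap xr inferInstance

/-- The sigma-algebra generated by the complete covariate vector. -/
abbrev sigmaFull (pu pz pv : ℕ) : MeasurableSpace (Subject pu pz pv) :=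
  MeasurableSpace.comap full inferInstance

lemma sigmaXr_le : sigmaXr pu pz pv ≤ (inferInstance : MeasurableSpace (Subject pu pz pv)) :=
  measurable_xr.comap_le

end Coordinates

/-! ### Population quantities

A regression function is a measurable function that is a version of the corresponding
conditional expectation. -/

section Population

variable {pu pz pv : ℕ}

/-- `p a x` is a version of `P(A = a | Xr = x)`. -/
def IsPropensity (P : Measure (Subject pu pz pv)) (p : Arm → RctCov pu pz → ℝ) : Prop :=
  ∀ a, Measurable (p a) ∧
    (fun s => p a (xr s)) =ᵐ[P] P[(arm ⁻¹' {a}).indicator (fun _ => (1 : ℝ)) | sigmaXr pu pz pv]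

/-- `t x` is a version of `E[Y(1) - Y(-1) | Xr = x]`. -/
def IsCATE (P : Measure (Subject pu pz pv)) (t : RctCov pu pz → ℝ) : Prop :=
  Measurable t ∧
    (fun s => t (xr s)) =ᵐ[P]
      P[fun s => potential s true - potential s false | sigmaXr pu pz pv]

/-- `m a x` is a version of `E[Y | X = x, A = a]`, the full conditional mean outcome. -/
def IsArmMean (P : Measure (Subject pu pz pv)) (m : Arm → FullCov pu pz pv → ℝ) : Prop :=
  ∀ a, Measurable (m a) ∧
    (fun s => m a (full s)) =ᵐ[P[|arm ⁻¹' {a}]]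
      (P[|arm ⁻¹' {a}])[outcome | sigmaFull pu pz pv]

/-- `mt a x` is a version of `E[m a (X) | Xr = x]`, the marginalized arm-specific mean. -/
def IsMarginalArmMean (P : Measure (Subject pu pz pv)) (m : Arm → FullCov pu pz pv → ℝ)
    (mt : Arm → RctCov pu pz → ℝ) : Prop :=
  ∀ a, Measurable (mt a) ∧
    (fun s => mt a (xr s)) =ᵐ[P] P[fun s => m a (full s) | sigmaXr pu pz pv]

/-- Internal validity of the trial with law `P` and propensity `p`. Consistency is built into
`outcome`. The field `baseline` says that the randomization uses no covariate other than `Xr`. -/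
structure InternalValidity (P : Measure (Subject pu pz pv)) [IsProbabilityMeasure P]
    (p : Arm → RctCov pu pz → ℝ) : Prop where
  ignorable : CondIndepFun (sigmaXr pu pz pv) sigmaXr_le potential arm P
  baseline : CondIndepFun (sigmaXr pu pz pv) sigmaXr_le osOnly arm P
  overlap : ∃ ρ : ℝ, 0 < ρ ∧ ∀ a, ∀ᵐ s ∂P, ρ ≤ p a (xr s) ∧ p a (xr s) ≤ 1 - ρ

/-- Squared `L²` distance under the law of `Xr`: `E (f(Xr) - g(Xr))²`. -/
def sqDist (P : Measure (Subject pu pz pv)) (f g : RctCov pu pz → ℝ) : ℝ≥0∞ :=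
  ∫⁻ s, ENNReal.ofReal ((f (xr s) - g (xr s)) ^ 2) ∂P

/-- Approximation error of a class: the infimum of `sqDist` to the target over the class. -/
def approxError (P : Measure (Subject pu pz pv)) (H : Set (RctCov pu pz → ℝ))
    (t : RctCov pu pz → ℝ) : ℝ≥0∞ :=
  ⨅ h ∈ H, sqDist P h t

end Population

/-- Empirical Rademacher complexity at the sample `x`: the average over all sign vectors of
`sup_{h ∈ H} (1/n) ∑ εᵢ h(xᵢ)`. It is computed in the extended reals, so that an infinite
supremum gives the value `∞`. -/
def rademacher {E : Type*} {n : ℕ} (H : Set (E → ℝ)) (x : Fin n → E) : ℝ≥0∞ :=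
  (∑ ε : Fin n → Bool, ⨆ h ∈ H,
    (((n : ℝ)⁻¹ * ∑ i, sgn (ε i) * h (x i) : ℝ) : EReal)).toENNReal / 2 ^ n

/-! ### The estimator -/

/-- The function classes: OS outcome models on `Z`, arm-wise discrepancies on `Xr`, and the
second-stage CATE corrections on `Xr`. -/
structure Classes (pu pz : ℕ) where
  osClass : Arm → Set (EuclideanSpace ℝ (Fin pz) → ℝ)
  discClass : Arm → Set (RctCov pu pz → ℝ)
  cateClass : Set (RctCov pu pz → ℝ)

/-- The penalties of the three fitting steps. -/
structure Penalties (pu pz : ℕ) where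
  osPen : Arm → (EuclideanSpace ℝ (Fin pz) → ℝ) → ℝ
  discPen : Arm → (RctCov pu pz → ℝ) → ℝ
  catePen : (RctCov pu pz → ℝ) → ℝ

/-- The fitted functions: for every fold `k` and arm `a`, the OS outcome model and the discrepancy
that are fitted off the fold, and the second-stage CATE correction. -/
structure Fit (pu pz q : ℕ) where
  os : Fin q → Arm → EuclideanSpace ℝ (Fin pz) → ℝ
  disc : Fin q → Arm → RctCov pu pz → ℝ
  cate : RctCov pu pz → ℝ

/-- A trial sample of size `nr` and an observational sample of size `no`. -/
abbrev Data (pu pz pv nr no : ℕ) := (Fin nr → Subject pu pz pv) × (Fin no → Subject pu pz pv)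

/-- The law of the data: independent samples, i.i.d. within each source. -/
def dataLaw {pu pz pv : ℕ} (Pr Po : Measure (Subject pu pz pv)) (nr no : ℕ) :
    Measure (Data pu pz pv nr no) :=
  (Measure.pi fun _ : Fin nr => Pr).prod (Measure.pi fun _ : Fin no => Po)

section Estimator

variable {pu pz pv q nr no : ℕ}

/-- The class of arm-wise calibrated predictors `m(Z) + d(Xr)`, with `m` an OS outcome model and
`d` a discrepancy. -/
def Classes.representable (H : Classes pu pz) (a : Arm) : Set (RctCov pu pz → ℝ) :=
  {h | ∃ m ∈ H.osClass a, ∃ d ∈ H.discClass a, h = fun x => m x.2 + d x}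

/-- The squared mismatch penalty of shared-only borrowing. -/
def mismatch (P : Measure (Subject pu pz pv)) (H : Classes pu pz)
    (mt : Arm → RctCov pu pz → ℝ) : ℝ≥0∞ :=
  ∑ a, approxError P (H.representable a) (mt a)

/-- Calibrated arm-specific prediction of fold `k`. -/
def Fit.armMean (f : Fit pu pz q) (k : Fin q) (a : Arm) (x : RctCov pu pz) : ℝ :=
  f.os k a x.2 + f.disc k a x

/-- Shared-only counterfactual mean outcome of fold `k`: the weight of an arm is the propensity of
the opposite arm. -/
def Fit.cmo (p : Arm → RctCov pu pz → ℝ) (f : Fit pu pz q) (k : Fin q) (x : RctCov pu pz) : ℝ :=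
  ∑ a, p (!a) x * f.armMean k a x

/-- Preliminary CATE of fold `k`. -/
def Fit.prelim (f : Fit pu pz q) (k : Fin q) (x : RctCov pu pz) : ℝ :=
  ∑ a, sgn a * f.armMean k a x

/-- The pseudo-outcome `A (Y - m(Xr)) / p_A(Xr)`. -/
def pseudo (p : Arm → RctCov pu pz → ℝ) (m : RctCov pu pz → ℝ) (s : Subject pu pz pv) : ℝ :=
  sgn (arm s) * (outcome s - m (xr s)) / p (arm s) (xr s)

/-- Average of `loss` over the units of arm `a` that lie outside fold `k` (`0` if there are
none). -/
def armAvg {n : ℕ} (x : Fin n → Subject pu pz pv) (fold : Fin n → Fin q) (k : Fin q) (a : Arm)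
    (loss : Subject pu pz pv → ℝ) : ℝ :=
  let I := Finset.univ.filter fun i => fold i ≠ k ∧ arm (x i) = a
  (I.card : ℝ)⁻¹ * ∑ i ∈ I, loss (x i)

/-- `f` is a cross-fitted SR-OSCAR fit on the data `w`: all steps are penalized empirical risk
minimizations in their classes. The OS outcome models and the discrepancies of fold `k` use the
units outside fold `k`, and the trial unit `i` enters the second stage through the pseudo-outcome
and the preliminary CATE of its own fold. -/
structure IsFit (H : Classes pu pz) (pen : Penalties pu pz) (p : Arm → RctCov pu pz → ℝ)
    (foldR : Fin nr → Fin q) (foldO : Fin no → Fin q) (w : Data pu pz pv nr no)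
    (f : Fit pu pz q) : Prop where
  os_mem : ∀ k a, f.os k a ∈ H.osClass a
  os_min : ∀ k a, IsMinOn
    (fun m => armAvg w.2 foldO k a (fun s => (outcome s - m (shared s)) ^ 2) + pen.osPen a m)
    (H.osClass a) (f.os k a)
  disc_mem : ∀ k a, f.disc k a ∈ H.discClass a
  disc_min : ∀ k a, IsMinOn
    (fun d => armAvg w.1 foldR k a
      (fun s => (outcome s - f.os k a (shared s) - d (xr s)) ^ 2) + pen.discPen a d)
    (H.discClass a) (f.disc k a)
  cate_mem : f.cate ∈ H.cateClass
  cate_min : IsMinOn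
    (fun d => (nr : ℝ)⁻¹ * ∑ i, (pseudo p (f.cmo p (foldR i)) (w.1 i)
      - (f.prelim (foldR i) (xr (w.1 i)) + d (xr (w.1 i)))) ^ 2 + pen.catePen d)
    H.cateClass f.cate

/-- Proportion of the trial units that lie in fold `k`. -/
def foldWeight (fold : Fin nr → Fin q) (k : Fin q) : ℝ :=
  ((Finset.univ.filter fun i => fold i = k).card : ℝ) / nr

/-- The SR-OSCAR CATE estimator: the preliminary CATE, aggregated over the folds, plus the
second-stage correction. -/
def Fit.tauHat (f : Fit pu pz q) (fold : Fin nr → Fin q) (x : RctCov pu pz) : ℝ :=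
  (∑ k, foldWeight fold k * f.prelim k x) + f.cate x

/-- Population version of the (unpenalized) second-stage risk, for given off-fold nuisances. -/
def secondStageRisk (P : Measure (Subject pu pz pv)) (p : Arm → RctCov pu pz → ℝ)
    (fold : Fin nr → Fin q) (f : Fit pu pz q) (d : RctCov pu pz → ℝ) : ℝ≥0∞ :=
  ∑ k, ENNReal.ofReal (foldWeight fold k) *
    ∫⁻ s, ENNReal.ofReal
      ((pseudo p (f.cmo p k) s - (f.prelim k (xr s) + d (xr s))) ^ 2) ∂P

/-- The estimation errors of all steps, for the data `w` and the fit `f`: each squared `L²` error,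
for an independent trial draw, is at most `κ` times the squared Rademacher complexity of its class
plus `t`. The targets of the outcome models and of the discrepancies are `mS` and `dS`, the target
of the second stage minimizes the population second-stage risk over its class up to `e`. -/
structure Accurate (P : Measure (Subject pu pz pv)) (H : Classes pu pz)
    (p : Arm → RctCov pu pz → ℝ) (foldR : Fin nr → Fin q)
    (mS : Arm → EuclideanSpace ℝ (Fin pz) → ℝ) (dS : Arm → RctCov pu pz → ℝ)
    (κ e t : ℝ≥0∞) (w : Data pu pz pv nr no) (f : Fit pu pz q) : Prop where
  os_le : ∀ k a, sqDist P (fun x => f.os k a x.2) (fun x => mS a x.2) ≤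
    κ * (rademacher (H.osClass a) (fun i => shared (w.2 i)) ^ 2 + t)
  disc_le : ∀ k a, sqDist P (f.disc k a) (dS a) ≤
    κ * (rademacher (H.discClass a) (fun i => xr (w.1 i)) ^ 2 + t)
  cate_le : ∃ d₀ ∈ H.cateClass,
    (∀ d ∈ H.cateClass, secondStageRisk P p foldR f d₀ ≤ secondStageRisk P p foldR f d + e) ∧
    sqDist P f.cate d₀ ≤ κ * (rademacher H.cateClass (fun i => xr (w.1 i)) ^ 2 + t)

/-- Rates for the (cross-fitted) estimators `F`, with constant `κ`: for oracle elements `mS a`,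
`dS a` of the classes whose sum attains the infimum in the mismatch penalty up to an arbitrarily
small `e`, all estimation errors are of the order of the squared Rademacher complexities, outside
an event of probability at most `γ` and up to `log (1/γ) / nr`, for every `γ`. -/
def Rates (Pr Po : Measure (Subject pu pz pv)) (H : Classes pu pz)
    (p : Arm → RctCov pu pz → ℝ) (mt : Arm → RctCov pu pz → ℝ) (foldR : Fin nr → Fin q)
    (κ : ℝ) (F : Data pu pz pv nr no → Fit pu pz q) : Prop :=
  ∀ e : ℝ≥0∞, 0 < e → ∃ mS dS,
    (∀ a, mS a ∈ H.osClass a ∧ dS a ∈ H.discClass a ∧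
      sqDist Pr (fun x => mS a x.2 + dS a x) (mt a) ≤
        approxError Pr (H.representable a) (mt a) + e) ∧
    ∀ γ : ℝ, 0 < γ → γ < 1 →
      dataLaw Pr Po nr no {w | ¬ Accurate Pr H p foldR mS dS (ENNReal.ofReal κ) e
        (ENNReal.ofReal (Real.log (1 / γ) / nr)) w (F w)} ≤ ENNReal.ofReal γ

/-- The right-hand side of the risk bound. -/
def riskBound (P : Measure (Subject pu pz pv)) (H : Classes pu pz)
    (t : RctCov pu pz → ℝ) (mt : Arm → RctCov pu pz → ℝ) (C γ : ℝ)
    (w : Data pu pz pv nr no) : ℝ≥0∞ :=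
  approxError P H.cateClass t
    + ENNReal.ofReal C * (mismatch P H mt
        + rademacher H.cateClass (fun i => xr (w.1 i)) ^ 2
        + ∑ a, (rademacher (H.osClass a) (fun i => shared (w.2 i)) ^ 2
            + rademacher (H.discClass a) (fun i => xr (w.1 i)) ^ 2))
    + ENNReal.ofReal (C * Real.log (1 / γ) / nr)

end Estimator

end SROscar

end

/-! Inverse propensity weighting makes the pseudo-outcome unbiased for the CATE given `Xr`, whatever
augmentation is used: the augmentation enters the two arms with opposite signs
(`integral_pseudo_mul`). With the fits held fixed, the population second-stage risk of `d` is
therefore a constant plus `‖pooled + d - τ‖²`, where `pooled` is the fold-weighted preliminary CATE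
(`exists_secondStageRisk_eq`). Since `0` belongs to the correction class, a near-minimizer `d₀`
satisfies `‖pooled + d₀ - τ‖² ≤ ‖pooled - τ‖² + e`: the second stage cannot do appreciable harm.

It remains to bound the preliminary CATE. Internal validity identifies the marginalized arm mean
with `E[Y(a) | Xr]`, so `τ` is the contrast of these means (`IsCATE.ae_eq_contrast`). By Jensen over
folds, the error of `pooled` is controlled by the arm-wise errors, and each of those by the two
estimation errors and the oracle error (`Accurate.sqDist_armMean_le`). The distance from `f.cate` to
`d₀` is one more rate.

The argument is deterministic on the event where the rates hold. It bounds the risk by the bracket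
and the logarithmic term alone; the approximation error of the correction class is a nonnegative
term added at the end. -/

noncomputable section

namespace SROscar

/-! ### Conditional independence as a change of measure -/

section

/-- If `W` and `T` are conditionally independent given `X`, then restricting to `T ∈ S` acts on the
joint law of `(X, W)` as weighting by the conditional probability of `T ∈ S`. -/
theorem map_restrict_eq_map_withDensity {Ω E F B : Type*} [mΩ : MeasurableSpace Ω]
    [StandardBorelSpace Ω] [mE : MeasurableSpace E] [MeasurableSpace F] [MeasurableSpace B]
    {P : Measure Ω} [IsProbabilityMeasure P] {X : Ω → E} {W : Ω → F} {T : Ω → B}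
    (hX : Measurable X) (hW : Measurable W) (hT : Measurable T)
    {hle : MeasurableSpace.comap X mE ≤ mΩ}
    (hind : CondIndepFun (MeasurableSpace.comap X mE) hle W T P)
    {S : Set B} (hS : MeasurableSet S) {p : E → ℝ} (hp : Measurable p)
    (hpe : (fun ω => p (X ω)) =ᵐ[P]
      P[(T ⁻¹' S).indicator (fun _ => (1 : ℝ)) | MeasurableSpace.comap X mE]) :
    (P.restrict (T ⁻¹' S)).map (fun ω => (X ω, W ω)) =
      (P.withDensity fun ω => ENNReal.ofReal (p (X ω))).map (fun ω => (X ω, W ω)) := by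
  have hXW : Measurable fun ω => (X ω, W ω) := hX.prodMk hW
  have hTS : MeasurableSet (T ⁻¹' S) := hT hS
  have hpint : Integrable (fun ω => p (X ω)) P := integrable_condExp.congr hpe.symm
  have hpm : StronglyMeasurable[MeasurableSpace.comap X mE] (fun ω => p (X ω)) :=
    (hp.comp (comap_measurable X)).stronglyMeasurable
  have hpnn : 0 ≤ᵐ[P] fun ω => p (X ω) := by
    have h0 : 0 ≤ᵐ[P] P[(T ⁻¹' S).indicator (fun _ => (1 : ℝ)) | MeasurableSpace.comap X mE] :=
      condExp_nonneg (Filter.Eventually.of_forall fun ω =>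
        Set.indicator_nonneg (fun _ _ => zero_le_one) ω)
    filter_upwards [hpe, h0] with ω h1 h2
    simpa only [Pi.zero_apply, h1] using h2
  refine Measure.ext_prod fun {b c} hb hc => ?_
  have hbX : MeasurableSet[MeasurableSpace.comap X mE] (X ⁻¹' b) := ⟨b, hb, rfl⟩
  have hbX' : MeasurableSet (X ⁻¹' b) := hX hb
  have hcW : MeasurableSet (W ⁻¹' c) := hW hc
  have hpre : (fun ω => (X ω, W ω)) ⁻¹' (b ×ˢ c) = X ⁻¹' b ∩ W ⁻¹' c := rfl
  rw [Measure.map_apply hXW (hb.prod hc), Measure.map_apply hXW (hb.prod hc), hpre,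
    Measure.restrict_apply (hbX'.inter hcW), withDensity_apply _ (hbX'.inter hcW)]
  rw [← ofReal_integral_eq_lintegral_ofReal hpint.integrableOn (ae_restrict_of_ae hpnn)]
  have hci := (condIndepFun_iff_condExp_inter_preimage_eq_mul hW hT).1 hind c S hc hS
  have hprod : (W ⁻¹' c).indicator (fun ω => p (X ω)) =
      (W ⁻¹' c).indicator (fun _ => (1 : ℝ)) * fun ω => p (X ω) := by
    ext ω; by_cases h : ω ∈ W ⁻¹' c <;> simp [h]
  have hint1 : Integrable ((W ⁻¹' c).indicator (fun _ => (1 : ℝ))) P :=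
    (integrable_const _).indicator hcW
  have hint2 : Integrable ((W ⁻¹' c).indicator (fun ω => p (X ω))) P := hpint.indicator hcW
  have hpull := condExp_mul_of_stronglyMeasurable_right (m := MeasurableSpace.comap X mE)
    (f := (W ⁻¹' c).indicator (fun _ => (1 : ℝ))) hpm (hprod ▸ hint2) hint1
  -- Given `X`, the weight `p (X ω)` pulls out of the conditional expectation of its product with
  -- the indicator of `W ∈ c`. This leaves the product of the conditional probabilities of `W ∈ c`
  -- and `T ∈ S`, which by independence is that of the intersection.
  have key : ∫ ω in X ⁻¹' b ∩ W ⁻¹' c, p (X ω) ∂P = P.real (X ⁻¹' b ∩ W ⁻¹' c ∩ T ⁻¹' S) := by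
    rw [← setIntegral_indicator hcW, ← setIntegral_condExp hle hint2 hbX, hprod]
    have hint3 : Integrable ((W ⁻¹' c ∩ T ⁻¹' S).indicator (fun _ => (1 : ℝ))) P :=
      (integrable_const _).indicator (hcW.inter hTS)
    have : ∫ ω in X ⁻¹' b, (P[(W ⁻¹' c).indicator (fun _ => (1 : ℝ)) * (fun ω => p (X ω)) |
        MeasurableSpace.comap X mE]) ω ∂P = ∫ ω in X ⁻¹' b,
        (P[(W ⁻¹' c ∩ T ⁻¹' S).indicator (fun _ => (1 : ℝ)) | MeasurableSpace.comap X mE]) ω ∂P := by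
      refine setIntegral_congr_ae hbX' ?_
      filter_upwards [hpull, hci, hpe] with ω h1 h2 h3 _
      rw [h1, h2, Pi.mul_apply, h3]
    rw [this, setIntegral_condExp hle hint3 hbX, setIntegral_indicator (hcW.inter hTS),
      ← Set.inter_assoc]
    simp [Measure.real]
  rw [key, Measure.real, ENNReal.ofReal_toReal (measure_ne_top _ _)]

end

/-! ### Inverse propensity weighting and identification of the arm means -/

section

lemma aestronglyMeasurable_div {Ω : Type*} [MeasurableSpace Ω] {μ : Measure Ω} {f g : Ω → ℝ}
    (hf : AEStronglyMeasurable f μ) (hg : Measurable g) :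
    AEStronglyMeasurable (fun ω => f ω / g ω) μ := by
  simp only [div_eq_mul_inv]
  exact hf.mul hg.inv.aestronglyMeasurable

section Weighting

variable {Ω G : Type*} [MeasurableSpace Ω] [MeasurableSpace G] {P : Measure Ω} {A : Set Ω}
  {Q : Ω → G} {r : G → ℝ}

/-- The weight `1 / r` cancels the density `r`. The equivalence is needed because an arm regression
is a priori integrable only on its own arm. -/
theorem integrableOn_div_iff_of_map_restrict_eq (hQ : Measurable Q) (hr : Measurable r)
    (hpos : ∀ᵐ ω ∂P, 0 < r (Q ω))
    (h : (P.restrict A).map Q = (P.withDensity fun ω => ENNReal.ofReal (r (Q ω))).map Q)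
    {g : G → ℝ} (hg : AEStronglyMeasurable g (P.map Q)) :
    IntegrableOn (fun ω => g (Q ω) / r (Q ω)) A P ↔ Integrable (fun ω => g (Q ω)) P := by
  have hac : (P.restrict A).map Q ≪ P.map Q :=
    (Measure.absolutelyContinuous_of_le Measure.restrict_le_self).map hQ
  have hgr : AEStronglyMeasurable (fun y => g y / r y) ((P.restrict A).map Q) :=
    aestronglyMeasurable_div (hg.mono_ac hac) hr
  have h1 := integrable_map_measure hgr hQ.aemeasurable
  have h2 := integrable_map_measure (h ▸ hgr) hQ.aemeasurable
  rw [h, h2, integrable_withDensity_iff_integrable_smul'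
      (f := fun ω => ENNReal.ofReal (r (Q ω))) (hr.comp hQ).ennreal_ofReal
    (Filter.Eventually.of_forall fun _ => ENNReal.ofReal_lt_top)] at h1
  refine h1.symm.trans (integrable_congr ?_)
  filter_upwards [hpos] with ω hω
  simp [ENNReal.toReal_ofReal hω.le, mul_div_cancel₀ _ hω.ne']

/-- The same cancellation for values. Integrability is not required: the changes of variables also
respect the default value `0` of the integral. -/
theorem setIntegral_div_of_map_restrict_eq (hQ : Measurable Q) (hr : Measurable r)
    (hpos : ∀ᵐ ω ∂P, 0 < r (Q ω))
    (h : (P.restrict A).map Q = (P.withDensity fun ω => ENNReal.ofReal (r (Q ω))).map Q)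
    {g : G → ℝ} (hg : AEStronglyMeasurable g (P.map Q)) :
    ∫ ω in A, g (Q ω) / r (Q ω) ∂P = ∫ ω, g (Q ω) ∂P := by
  have hac : (P.restrict A).map Q ≪ P.map Q :=
    (Measure.absolutelyContinuous_of_le Measure.restrict_le_self).map hQ
  have hgr : AEStronglyMeasurable (fun y => g y / r y) ((P.restrict A).map Q) :=
    aestronglyMeasurable_div (hg.mono_ac hac) hr
  have h1 := integral_map hQ.aemeasurable hgr
  rw [h, integral_map hQ.aemeasurable (h ▸ hgr),
    integral_withDensity_eq_integral_toReal_smul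
      (f := fun ω => ENNReal.ofReal (r (Q ω))) (hr.comp hQ).ennreal_ofReal
    (Filter.Eventually.of_forall fun _ => ENNReal.ofReal_lt_top)] at h1
  rw [← h1]
  refine integral_congr_ae ?_
  filter_upwards [hpos] with ω hω
  simp [ENNReal.toReal_ofReal hω.le, mul_div_cancel₀ _ hω.ne']

end Weighting

variable {pu pz pv : ℕ} {P : Measure (Subject pu pz pv)} [IsProbabilityMeasure P]
  {p : Arm → RctCov pu pz → ℝ}

lemma measurable_full : Measurable (full : Subject pu pz pv → FullCov pu pz pv) := measurable_fst

lemma measurable_shared : Measurable (shared : Subject pu pz pv → EuclideanSpace ℝ (Fin pz)) :=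
  measurable_snd.comp measurable_xr

lemma measurable_osOnly : Measurable (osOnly : Subject pu pz pv → EuclideanSpace ℝ (Fin pv)) :=
  measurable_snd.comp measurable_fst

lemma measurable_arm : Measurable (arm : Subject pu pz pv → Arm) :=
  measurable_fst.comp measurable_snd

lemma measurable_potential : Measurable (potential : Subject pu pz pv → Arm → ℝ) :=
  measurable_snd.comp measurable_snd

lemma measurableSet_arm (a : Arm) : MeasurableSet (arm (pu := pu) (pz := pz) (pv := pv) ⁻¹' {a}) :=
  measurable_arm (measurableSet_singleton a)

lemma InternalValidity.propensity_pos (hv : InternalValidity P p) (a : Arm) :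
    ∀ᵐ s ∂P, 0 < p a (xr s) := by
  obtain ⟨ρ, hρ, h⟩ := hv.overlap
  filter_upwards [h a] with s hs using hρ.trans_le hs.1

lemma InternalValidity.propensity_le_one (hv : InternalValidity P p) (a : Arm) :
    ∀ᵐ s ∂P, p a (xr s) ≤ 1 := by
  obtain ⟨ρ, hρ, h⟩ := hv.overlap
  filter_upwards [h a] with s hs using by linarith [hs.2]

section Transfer

variable {a : Arm} {F : Type*} [MeasurableSpace F] {W : Subject pu pz pv → F}

/-- Inverse propensity weighting recovers the means of functions of `Xr` and `W`, for `W`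
conditionally independent of the treatment. -/
theorem setIntegral_arm_div_propensity (hv : InternalValidity P p) (hp : IsPropensity P p)
    (hW : Measurable W) (hind : CondIndepFun (sigmaXr pu pz pv) sigmaXr_le W arm P)
    {g : RctCov pu pz × F → ℝ}
    (hg : AEStronglyMeasurable g (P.map fun s => (xr s, W s))) :
    ∫ s in arm ⁻¹' {a}, g (xr s, W s) / p a (xr s) ∂P = ∫ s, g (xr s, W s) ∂P :=
  setIntegral_div_of_map_restrict_eq (A := arm ⁻¹' {a})
    (Q := fun s => (xr s, W s)) (r := fun y => p a y.1) (g := g) (measurable_xr.prodMk hW)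
    ((hp a).1.comp measurable_fst) (hv.propensity_pos a)
    (map_restrict_eq_map_withDensity measurable_xr hW measurable_arm hind
      (measurableSet_singleton a) (hp a).1 (hp a).2) hg

theorem integrableOn_arm_div_propensity_iff (hv : InternalValidity P p) (hp : IsPropensity P p)
    (hW : Measurable W) (hind : CondIndepFun (sigmaXr pu pz pv) sigmaXr_le W arm P)
    {g : RctCov pu pz × F → ℝ}
    (hg : AEStronglyMeasurable g (P.map fun s => (xr s, W s))) :
    IntegrableOn (fun s => g (xr s, W s) / p a (xr s)) (arm ⁻¹' {a}) P ↔
      Integrable (fun s => g (xr s, W s)) P :=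
  integrableOn_div_iff_of_map_restrict_eq (A := arm ⁻¹' {a})
    (Q := fun s => (xr s, W s)) (r := fun y => p a y.1) (g := g) (measurable_xr.prodMk hW)
    ((hp a).1.comp measurable_fst) (hv.propensity_pos a)
    (map_restrict_eq_map_withDensity measurable_xr hW measurable_arm hind
      (measurableSet_singleton a) (hp a).1 (hp a).2) hg

end Transfer

/-- On the arm, the inverse propensity integrates to `1`, which is impossible over a null set. This
makes the conditional law given the arm a probability measure. -/
lemma measure_arm_ne_zero (hv : InternalValidity P p) (hp : IsPropensity P p) (a : Arm) :
    P (arm ⁻¹' {a}) ≠ 0 := by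
  intro h0
  have h := setIntegral_arm_div_propensity (a := a) (g := fun _ => 1) hv hp measurable_potential
    hv.ignorable aestronglyMeasurable_const
  rw [Measure.restrict_eq_zero.2 h0] at h
  simp at h

/-- Inverse propensity weights are bounded. -/
lemma memLp_div_propensity (hv : InternalValidity P p) (hp : IsPropensity P p) (a : Arm)
    {f : Subject pu pz pv → ℝ} {q : ℝ≥0∞} {ν : Measure (Subject pu pz pv)} (hν : ν ≪ P)
    (hf : MemLp f q ν) :
    MemLp (fun s => f s / p a (xr s)) q ν := by
  obtain ⟨ρ, hρ, h⟩ := hv.overlap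
  refine hf.of_le_mul (c := ρ⁻¹)
    (aestronglyMeasurable_div hf.1 ((hp a).1.comp measurable_xr)) ?_
  filter_upwards [hν.ae_le (h a)] with s hs
  rw [norm_div, div_eq_inv_mul, Real.norm_of_nonneg (hρ.le.trans hs.1)]
  gcongr
  exact hs.1

/-- The marginalized arm-specific mean is the conditional mean of the potential outcome. -/
theorem IsMarginalArmMean.ae_eq_condExp_potential (hv : InternalValidity P p)
    (hp : IsPropensity P p) (hY : ∀ a, MemLp (fun s => potential s a) 2 P)
    {m : Arm → FullCov pu pz pv → ℝ} (hm : IsArmMean P m)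
    {mt : Arm → RctCov pu pz → ℝ} (hmt : IsMarginalArmMean P m mt) (a : Arm) :
    (fun s => mt a (xr s)) =ᵐ[P] P[fun s => potential s a | sigmaXr pu pz pv] := by
  obtain ⟨hmeas, hae⟩ := hm a
  set A : Set (Subject pu pz pv) := arm ⁻¹' {a} with hA
  have hA0 : P A ≠ 0 := measure_arm_ne_zero hv hp a
  have hAm : MeasurableSet A := measurableSet_arm a
  have hc0 : (P A)⁻¹ ≠ 0 := ENNReal.inv_ne_zero.2 (measure_ne_top _ _)
  have hctop : (P A)⁻¹ ≠ ∞ := ENNReal.inv_ne_top.2 hA0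
  have hcond : P[|A] = (P A)⁻¹ • P.restrict A := rfl
  have : IsProbabilityMeasure P[|A] := cond_isProbabilityMeasure hA0
  have hν : P[|A] ≪ P := cond_absolutelyContinuous
  have hYint : Integrable (fun s => potential s a) P := (hY a).integrable one_le_two
  have houtae : outcome =ᵐ[P.restrict A] fun s => potential s a := by
    filter_upwards [ae_restrict_mem hAm] with s hs
    have : arm s = a := hs
    simp [outcome, this]
  have houtA : IntegrableOn outcome A P := hYint.integrableOn.congr houtae.symm
  have hout : Integrable outcome P[|A] := by
    rw [hcond]; exact houtA.smul_measure hctop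
  have hmA : Integrable (fun s => m a (full s)) P[|A] := integrable_condExp.congr hae.symm
  have hmdiv : IntegrableOn (fun s => m a (full s) / p a (xr s)) A P := by
    have := memLp_one_iff_integrable.1
      (memLp_div_propensity hv hp a hν (memLp_one_iff_integrable.2 hmA))
    rw [hcond] at this
    exact (integrable_smul_measure hc0 hctop).1 this
  -- The independence of `V` and the treatment given `Xr` carries integrability from the arm to the
  -- whole trial population.
  have hmP : Integrable (fun s => m a (full s)) P :=
    (integrableOn_arm_div_propensity_iff (g := m a) hv hp measurable_osOnly hv.baseline
      hmeas.aestronglyMeasurable).1 hmdiv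
  have key : ∀ b, MeasurableSet b →
      ∫ s in xr ⁻¹' b, m a (full s) ∂P = ∫ s in xr ⁻¹' b, potential s a ∂P := by
    intro b hb
    have hbm : MeasurableSet (xr (pu := pu) (pz := pz) (pv := pv) ⁻¹' b) := measurable_xr hb
    -- As a function of `X`, this test function allows the outcome to be replaced by its regression
    -- within the arm; its factor `1 / p a` then turns both arm integrals into population integrals
    -- over `xr ⁻¹' b`.
    let h : RctCov pu pz → ℝ := fun x => b.indicator (fun _ => 1) x / p a x
    have hh : Measurable h := (measurable_const.indicator hb).div (hp a).1
    have hhs : StronglyMeasurable[sigmaFull pu pz pv] fun s : Subject pu pz pv => h (xr s) :=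
      ((hh.comp measurable_fst).comp (comap_measurable full)).stronglyMeasurable
    have hind : ∀ f : Subject pu pz pv → ℝ, Integrable f P[|A] →
        Integrable (f * fun s => h (xr s)) P[|A] := by
      intro f hf
      have h1 : Integrable ((xr ⁻¹' b).indicator f) P[|A] := hf.indicator hbm
      have h2 := memLp_one_iff_integrable.1
        (memLp_div_propensity hv hp a hν (memLp_one_iff_integrable.2 h1))
      refine h2.congr (Filter.Eventually.of_forall fun s => ?_)
      by_cases hs : xr s ∈ b <;> simp [h, hs, div_eq_mul_inv]
    have hpull := condExp_mul_of_stronglyMeasurable_right hhs (hind _ hout) hout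
    have e1 : ∫ s, m a (full s) * h (xr s) ∂P[|A] = ∫ s, outcome s * h (xr s) ∂P[|A] := by
      rw [← integral_condExp (m := sigmaFull pu pz pv) (measurable_full.comap_le)
        (f := fun s => outcome s * h (xr s))]
      refine integral_congr_ae ?_
      filter_upwards [hae, hpull] with s h1 h2
      rw [h1]
      exact h2.symm
    rw [hcond, integral_smul_measure, integral_smul_measure] at e1
    have e2 : ∫ s in A, m a (full s) * h (xr s) ∂P = ∫ s in A, outcome s * h (xr s) ∂P :=
      smul_right_injective ℝ (ENNReal.toReal_ne_zero.2 ⟨hc0, hctop⟩) e1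
    -- The regression is a function of `(Xr, V)` and is transferred by `baseline`; the potential
    -- outcome in `e4` is transferred by `ignorable`.
    have e3 := setIntegral_arm_div_propensity (a := a)
      (g := fun y => b.indicator (fun _ => 1) y.1 * m a y) hv hp
      measurable_osOnly hv.baseline (((measurable_const.indicator hb).comp
        measurable_fst).mul hmeas).aestronglyMeasurable
    have e4 := setIntegral_arm_div_propensity (a := a)
      (g := fun y => b.indicator (fun _ => 1) y.1 * y.2 a) hv hp
      measurable_potential hv.ignorable (((measurable_const.indicator hb).comp
        measurable_fst).mul ((measurable_pi_apply a).comp measurable_snd)).aestronglyMeasurable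
    have e5 : ∀ f : Subject pu pz pv → ℝ,
        ∫ s, b.indicator (fun _ => 1) (xr s) * f s ∂P = ∫ s in xr ⁻¹' b, f s ∂P := by
      intro f
      rw [← integral_indicator hbm]
      refine integral_congr_ae (Filter.Eventually.of_forall fun s => ?_)
      by_cases hs : xr s ∈ b <;> simp [hs]
    rw [← e5, ← e5]
    refine (e3.symm.trans ?_).trans e4
    have c1 : ∫ s in A, b.indicator (fun _ => 1) (xr s) * m a (xr s, osOnly s) / p a (xr s) ∂P =
        ∫ s in A, m a (full s) * h (xr s) ∂P := by
      congr 1; ext s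
      change _ = m a (xr s, osOnly s) * _
      simp only [h]; ring
    rw [c1, e2]
    refine integral_congr_ae ?_
    filter_upwards [houtae] with s hs
    simp only [h, hs]; ring
  refine (hmt a).2.trans ?_
  refine ae_eq_condExp_of_forall_setIntegral_eq sigmaXr_le hYint
    (fun _ _ _ => integrable_condExp.integrableOn) ?_
    stronglyMeasurable_condExp.aestronglyMeasurable
  rintro _ ⟨b, hb, rfl⟩ _
  rw [setIntegral_condExp sigmaXr_le hmP ⟨b, hb, rfl⟩, key b hb]

end

/-! ### The CATE as a contrast, and unbiasedness of the pseudo-outcome -/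

section

lemma integrable_mul_of_memLp_two {Ω : Type*} [MeasurableSpace Ω] {μ : Measure Ω} {u v : Ω → ℝ}
    (hu : MemLp u 2 μ) (hv : MemLp v 2 μ) : Integrable (fun ω => u ω * v ω) μ :=
  hu.integrable_mul hv

variable {pu pz pv : ℕ} {P : Measure (Subject pu pz pv)}
  {p : Arm → RctCov pu pz → ℝ}

lemma memLp_comp_xr {f : RctCov pu pz → ℝ} {q : ℝ≥0∞} (hf : MemLp f q (P.map xr)) :
    MemLp (fun s => f (xr s)) q P :=
  hf.comp_of_map measurable_xr.aemeasurable

lemma memLp_comp_shared {m : EuclideanSpace ℝ (Fin pz) → ℝ} {q : ℝ≥0∞}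
    (hm : MemLp m q (P.map shared)) :
    MemLp (fun x : RctCov pu pz => m x.2) q (P.map xr) := by
  have h : P.map shared = (P.map xr).map (Prod.snd : RctCov pu pz → _) :=
    (Measure.map_map measurable_snd measurable_xr).symm
  rw [h] at hm
  exact hm.comp_of_map measurable_snd.aemeasurable

lemma IsCATE.memLp {τ : RctCov pu pz → ℝ} (hτ : IsCATE P τ)
    (hY : ∀ a, MemLp (fun s => potential s a) 2 P) : MemLp τ 2 (P.map xr) :=
  (memLp_map_measure_iff hτ.1.aestronglyMeasurable measurable_xr.aemeasurable).2
    ((memLp_congr_ae hτ.2).2 (((hY true).sub (hY false)).condExp one_le_two))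

variable [IsProbabilityMeasure P]

lemma memLp_propensity_mul (hv : InternalValidity P p) (hp : IsPropensity P p) (a : Arm)
    {f : RctCov pu pz → ℝ} {q : ℝ≥0∞} (hf : MemLp f q (P.map xr)) :
    MemLp (fun x => p a x * f x) q (P.map xr) := by
  have hm : AEStronglyMeasurable (fun x => p a x * f x) (P.map xr) :=
    (hp a).1.aestronglyMeasurable.mul hf.1
  refine (memLp_map_measure_iff hm measurable_xr.aemeasurable).2 ?_
  refine (memLp_comp_xr hf).of_le (hm.comp_measurable measurable_xr) ?_
  filter_upwards [hv.propensity_pos a, hv.propensity_le_one a] with s h0 h1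
  simp only [Function.comp_apply, norm_mul, Real.norm_of_nonneg h0.le]
  exact mul_le_of_le_one_left (norm_nonneg _) h1

lemma IsMarginalArmMean.memLp (hv : InternalValidity P p)
    (hp : IsPropensity P p) (hY : ∀ a, MemLp (fun s => potential s a) 2 P)
    {m : Arm → FullCov pu pz pv → ℝ} (hm : IsArmMean P m)
    {mt : Arm → RctCov pu pz → ℝ} (hmt : IsMarginalArmMean P m mt) (a : Arm) :
    MemLp (mt a) 2 (P.map xr) :=
  (memLp_map_measure_iff (hmt a).1.aestronglyMeasurable measurable_xr.aemeasurable).2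
    ((memLp_congr_ae (hmt.ae_eq_condExp_potential hv hp hY hm a)).2 ((hY a).condExp one_le_two))

/-- The target CATE is the contrast of the marginalized arm-specific means. -/
theorem IsCATE.ae_eq_contrast {τ : RctCov pu pz → ℝ} (hτ : IsCATE P τ)
    (hv : InternalValidity P p) (hp : IsPropensity P p)
    (hY : ∀ a, MemLp (fun s => potential s a) 2 P)
    {m : Arm → FullCov pu pz pv → ℝ} (hm : IsArmMean P m)
    {mt : Arm → RctCov pu pz → ℝ} (hmt : IsMarginalArmMean P m mt) :
    ∀ᵐ s ∂P, τ (xr s) = ∑ a, sgn a * mt a (xr s) := by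
  filter_upwards [hτ.2, hmt.ae_eq_condExp_potential hv hp hY hm true,
    hmt.ae_eq_condExp_potential hv hp hY hm false,
    condExp_sub ((hY true).integrable one_le_two) ((hY false).integrable one_le_two)
      (sigmaXr pu pz pv)] with s h1 h2 h3 h4
  rw [h1, Fintype.sum_bool, h2, h3]
  refine h4.trans ?_
  simp [sgn, sub_eq_add_neg]

/-- Integrating the CATE against a function of the trial covariates. -/
theorem IsCATE.integral_mul {τ : RctCov pu pz → ℝ} (hτ : IsCATE P τ)
    (hY : ∀ a, MemLp (fun s => potential s a) 2 P) {h : RctCov pu pz → ℝ}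
    (hh : MemLp h 2 (P.map xr)) :
    ∫ s, (potential s true - potential s false) * h (xr s) ∂P = ∫ s, τ (xr s) * h (xr s) ∂P := by
  have hYd : MemLp (fun s => potential s true - potential s false) 2 P :=
    (hY true).sub (hY false)
  have hhP := memLp_comp_xr hh
  -- `h` is measurable only up to a null set, so a measurable modification, composed with `xr`,
  -- supplies the version measurable for the sigma-algebra of `Xr`.
  have hhm : AEStronglyMeasurable[sigmaXr pu pz pv] (fun s : Subject pu pz pv => h (xr s)) P :=
    ⟨fun s => hh.1.mk h (xr s),
      hh.1.stronglyMeasurable_mk.comp_measurable (comap_measurable xr),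
      ae_of_ae_map measurable_xr.aemeasurable hh.1.ae_eq_mk⟩
  have hpull := condExp_mul_of_aestronglyMeasurable_right hhm
    (hYd.integrable_mul hhP) (hYd.integrable one_le_two)
  rw [← integral_condExp (sigmaXr_le (pu := pu) (pz := pz) (pv := pv))
    (f := fun s => (potential s true - potential s false) * h (xr s))]
  refine integral_congr_ae ?_
  filter_upwards [hτ.2, hpull] with s h1 h2
  rw [h1]
  exact h2

/-- Only the received arm survives the indicators, and there the outcome is the potential one. This
form lets each arm be reweighted separately. -/
lemma pseudo_eq_sum (p : Arm → RctCov pu pz → ℝ) (m : RctCov pu pz → ℝ) (s : Subject pu pz pv) :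
    pseudo p m s = ∑ a, (arm ⁻¹' {a}).indicator
      (fun s => sgn a * ((potential s a - m (xr s)) / p a (xr s))) s := by
  rw [Finset.sum_eq_single (arm s)]
  · simp [pseudo, outcome, mul_div_assoc]
  · intro b _ hb
    have hs : s ∉ arm ⁻¹' {b} := fun h => hb (Eq.symm h)
    exact Set.indicator_of_notMem hs _
  · simp

lemma memLp_pseudo (hv : InternalValidity P p) (hp : IsPropensity P p)
    (hY : ∀ a, MemLp (fun s => potential s a) 2 P) {m : RctCov pu pz → ℝ}
    (hm : MemLp m 2 (P.map xr)) : MemLp (pseudo p m) 2 P := by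
  have h : MemLp (fun s => ∑ a, (arm ⁻¹' {a}).indicator
      (fun s => sgn a * ((potential s a - m (xr s)) / p a (xr s))) s) 2 P :=
    memLp_finsetSum _ fun a _ =>
      (((memLp_div_propensity hv hp a Measure.AbsolutelyContinuous.rfl
        ((hY a).sub (memLp_comp_xr hm))).const_mul (sgn a)).indicator (measurableSet_arm a))
  exact h.ae_eq (Filter.Eventually.of_forall fun s => (pseudo_eq_sum p m s).symm)

/-- The pseudo-outcome is conditionally unbiased for the CATE, whatever the augmentation `m`. -/
theorem integral_pseudo_mul (hv : InternalValidity P p) (hp : IsPropensity P p)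
    (hY : ∀ a, MemLp (fun s => potential s a) 2 P) {τ : RctCov pu pz → ℝ} (hτ : IsCATE P τ)
    {m h : RctCov pu pz → ℝ} (hm : MemLp m 2 (P.map xr)) (hh : MemLp h 2 (P.map xr)) :
    ∫ s, pseudo p m s * h (xr s) ∂P = ∫ s, τ (xr s) * h (xr s) ∂P := by
  have hhP := memLp_comp_xr hh
  have hmP := memLp_comp_xr hm
  have hYm : ∀ a, MemLp (fun s => potential s a - m (xr s)) 2 P := fun a => (hY a).sub hmP
  have hint : ∀ a, Integrable (fun s => (arm ⁻¹' {a}).indicator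
      (fun s => sgn a * ((potential s a - m (xr s)) / p a (xr s))) s * h (xr s)) P := fun a =>
    MemLp.integrable_mul (((memLp_div_propensity hv hp a Measure.AbsolutelyContinuous.rfl
      (hYm a)).const_mul (sgn a)).indicator (measurableSet_arm a)) hhP
  have harm : ∀ a, ∫ s, (arm ⁻¹' {a}).indicator
      (fun s => sgn a * ((potential s a - m (xr s)) / p a (xr s))) s * h (xr s) ∂P =
      sgn a * ∫ s, (potential s a - m (xr s)) * h (xr s) ∂P := by
    intro a
    have hfst : (P.map fun s => (xr s, potential s)).map Prod.fst = P.map xr :=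
      Measure.map_map measurable_fst (measurable_xr.prodMk measurable_potential)
    have hcomp : ∀ {f : RctCov pu pz → ℝ}, MemLp f 2 (P.map xr) →
        AEStronglyMeasurable (fun y : RctCov pu pz × (Arm → ℝ) => f y.1)
          (P.map fun s => (xr s, potential s)) := fun hf =>
      (hfst ▸ hf.1).comp_measurable measurable_fst
    have hg : AEStronglyMeasurable
        (fun y : RctCov pu pz × (Arm → ℝ) => (y.2 a - m y.1) * h y.1)
        (P.map fun s => (xr s, potential s)) :=
      ((((measurable_pi_apply a).comp measurable_snd).aestronglyMeasurable).sub (hcomp hm)).mul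
        (hcomp hh)
    rw [← setIntegral_arm_div_propensity (a := a)
      (g := fun y => (y.2 a - m y.1) * h y.1) hv hp measurable_potential hv.ignorable hg,
      ← integral_indicator (measurableSet_arm a), ← integral_const_mul]
    congr 1; ext s
    by_cases hs : s ∈ arm ⁻¹' {a}
    · simp only [Set.indicator_of_mem hs]; ring
    · simp only [Set.indicator_of_notMem hs]; ring
  simp_rw [pseudo_eq_sum, Finset.sum_mul]
  rw [integral_finsetSum _ fun a _ => hint a]
  simp_rw [harm]
  rw [← hτ.integral_mul hY hh, Fintype.sum_bool]
  simp only [sgn, if_true, Bool.false_eq_true, if_false, one_mul, neg_mul]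
  -- Once both arms are integrals over the same population, the terms in `m` cancel in the
  -- difference.
  rw [← sub_eq_add_neg, ← integral_sub (integrable_mul_of_memLp_two (hYm true) hhP)
    (integrable_mul_of_memLp_two (hYm false) hhP)]
  congr 1; ext s; ring

end

/-! ### Squared distances, aggregation over folds and the second-stage risk -/

section

section Distance

variable {pu pz pv : ℕ} {P : Measure (Subject pu pz pv)}

lemma aemeasurable_sq_sub {f g : RctCov pu pz → ℝ} (hf : MemLp f 2 (P.map xr))
    (hg : MemLp g 2 (P.map xr)) :
    AEMeasurable (fun s => ENNReal.ofReal ((f (xr s) - g (xr s)) ^ 2)) P :=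
  (((memLp_comp_xr hf).1.aemeasurable.sub (memLp_comp_xr hg).1.aemeasurable).pow_const
    2).ennreal_ofReal

lemma sqDist_eq_ofReal_integral {f g : RctCov pu pz → ℝ} (hf : MemLp f 2 (P.map xr))
    (hg : MemLp g 2 (P.map xr)) :
    sqDist P f g = ENNReal.ofReal (∫ s, (f (xr s) - g (xr s)) ^ 2 ∂P) :=
  (ofReal_integral_eq_lintegral_ofReal ((memLp_comp_xr hf).sub (memLp_comp_xr hg)).integrable_sq
    (Filter.Eventually.of_forall fun _ => sq_nonneg _)).symm

/-- A pointwise bound of squares by a nonnegative combination of squares integrates. -/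
lemma sqDist_le_sum {ι : Type*} (I : Finset ι) {f g : RctCov pu pz → ℝ} {c : ι → ℝ}
    {u v : ι → RctCov pu pz → ℝ} (hc : ∀ i ∈ I, 0 ≤ c i)
    (hu : ∀ i ∈ I, MemLp (u i) 2 (P.map xr)) (hv : ∀ i ∈ I, MemLp (v i) 2 (P.map xr))
    (h : ∀ᵐ s ∂P, (f (xr s) - g (xr s)) ^ 2 ≤
      ∑ i ∈ I, c i * (u i (xr s) - v i (xr s)) ^ 2) :
    sqDist P f g ≤ ∑ i ∈ I, ENNReal.ofReal (c i) * sqDist P (u i) (v i) := by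
  have h1 : sqDist P f g ≤ ∫⁻ s, ∑ i ∈ I,
      ENNReal.ofReal (c i) * ENNReal.ofReal ((u i (xr s) - v i (xr s)) ^ 2) ∂P := by
    refine lintegral_mono_ae ?_
    filter_upwards [h] with s hs
    refine (ENNReal.ofReal_le_ofReal hs).trans_eq ?_
    rw [ENNReal.ofReal_sum_of_nonneg fun i hi => mul_nonneg (hc i hi) (sq_nonneg _)]
    exact Finset.sum_congr rfl fun i hi => ENNReal.ofReal_mul (hc i hi)
  refine h1.trans_eq ?_
  rw [lintegral_finsetSum' _ fun i hi => (aemeasurable_sq_sub (hu i hi) (hv i hi)).const_mul _]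
  refine Finset.sum_congr rfl fun i hi => ?_
  rw [lintegral_const_mul'' _ (aemeasurable_sq_sub (hu i hi) (hv i hi))]
  rfl

lemma sqDist_le_two_mul_add {f g u₁ v₁ u₂ v₂ : RctCov pu pz → ℝ}
    (hu₁ : MemLp u₁ 2 (P.map xr)) (hv₁ : MemLp v₁ 2 (P.map xr))
    (hu₂ : MemLp u₂ 2 (P.map xr)) (hv₂ : MemLp v₂ 2 (P.map xr))
    (h : ∀ x, f x - g x = (u₁ x - v₁ x) + (u₂ x - v₂ x)) :
    sqDist P f g ≤ 2 * (sqDist P u₁ v₁ + sqDist P u₂ v₂) := by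
  have := sqDist_le_sum (P := P) (f := f) (g := g) (Finset.univ : Finset Bool) (c := fun _ => 2)
    (u := fun b => if b then u₁ else u₂) (v := fun b => if b then v₁ else v₂)
    (fun _ _ => zero_le_two) (by simp [hu₁, hu₂]) (by simp [hv₁, hv₂])
    (Filter.Eventually.of_forall fun s => by
      simp only [h, Fintype.sum_bool, if_true, Bool.false_eq_true, if_false]
      nlinarith [sq_nonneg ((u₁ (xr s) - v₁ (xr s)) - (u₂ (xr s) - v₂ (xr s)))])
  simpa [mul_add] using this

end Distance

lemma foldWeight_nonneg {nr q : ℕ} (fold : Fin nr → Fin q) (k : Fin q) : 0 ≤ foldWeight fold k := by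
  unfold foldWeight; positivity

lemma sum_foldWeight {nr q : ℕ} (hn : 0 < nr) (fold : Fin nr → Fin q) :
    ∑ k, foldWeight fold k = 1 := by
  simp only [foldWeight, ← Finset.sum_div, ← Nat.cast_sum]
  rw [Finset.sum_card_fiberwise_eq_card_filter]
  simp [hn.ne']

variable {pu pz pv nr q : ℕ} {P : Measure (Subject pu pz pv)}
  {p : Arm → RctCov pu pz → ℝ}

/-- The preliminary CATE, aggregated over the folds. -/
def Fit.pooled (f : Fit pu pz q) (fold : Fin nr → Fin q) (x : RctCov pu pz) : ℝ :=
  ∑ k, foldWeight fold k * f.prelim k x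

/-- All first-stage fits are square-integrable. -/
structure Fit.SquareIntegrable (P : Measure (Subject pu pz pv)) (f : Fit pu pz q) : Prop where
  os : ∀ k a, MemLp (f.os k a) 2 (P.map shared)
  disc : ∀ k a, MemLp (f.disc k a) 2 (P.map xr)

namespace Fit.SquareIntegrable

variable {f : Fit pu pz q}

lemma armMean (hf : f.SquareIntegrable P) (k : Fin q) (a : Arm) :
    MemLp (f.armMean k a) 2 (P.map xr) :=
  (memLp_comp_shared (hf.os k a)).add (hf.disc k a)

lemma prelim (hf : f.SquareIntegrable P) (k : Fin q) : MemLp (f.prelim k) 2 (P.map xr) :=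
  memLp_finsetSum _ fun a _ => (hf.armMean k a).const_mul (sgn a)

lemma pooled (hf : f.SquareIntegrable P) (fold : Fin nr → Fin q) :
    MemLp (f.pooled fold) 2 (P.map xr) :=
  memLp_finsetSum _ fun k _ => (hf.prelim k).const_mul (foldWeight fold k)

lemma cmo [IsProbabilityMeasure P] (hf : f.SquareIntegrable P) (hv : InternalValidity P p)
    (hp : IsPropensity P p) (k : Fin q) : MemLp (f.cmo p k) 2 (P.map xr) :=
  memLp_finsetSum _ fun a _ => memLp_propensity_mul hv hp (!a) (hf.armMean k a)

end Fit.SquareIntegrable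

lemma integral_sub_sq {Ω : Type*} [MeasurableSpace Ω] {μ : Measure Ω} {u v : Ω → ℝ}
    (hu : MemLp u 2 μ) (hv : MemLp v 2 μ) :
    ∫ ω, (u ω - v ω) ^ 2 ∂μ =
      ∫ ω, u ω ^ 2 ∂μ - 2 * ∫ ω, u ω * v ω ∂μ + ∫ ω, v ω ^ 2 ∂μ := by
  have huv := integrable_mul_of_memLp_two hu hv
  have hdiff : Integrable (fun ω => u ω ^ 2 - 2 * (u ω * v ω)) μ :=
    hu.integrable_sq.sub (huv.const_mul 2)
  rw [← integral_const_mul, ← integral_sub hu.integrable_sq (huv.const_mul 2),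
    ← integral_add hdiff hv.integrable_sq]
  congr 1; ext ω; ring

/-- The aggregated preliminary CATE inherits the errors of the arm-wise predictions. -/
theorem sqDist_pooled_le (hn : 0 < nr) {f : Fit pu pz q} (hf : f.SquareIntegrable P)
    (fold : Fin nr → Fin q) {τ : RctCov pu pz → ℝ} (hτ : MemLp τ 2 (P.map xr))
    {mt : Arm → RctCov pu pz → ℝ} (hmt : ∀ a, MemLp (mt a) 2 (P.map xr))
    (hcontrast : ∀ᵐ s ∂P, τ (xr s) = ∑ a, sgn a * mt a (xr s))
    {B : ℝ≥0∞} (hB : ∀ k, ∑ a, sqDist P (f.armMean k a) (mt a) ≤ B) :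
    sqDist P (f.pooled fold) τ ≤ 2 * B := by
  have hw := sum_foldWeight hn fold
  have h1 : sqDist P (f.pooled fold) τ ≤
      ∑ k, ENNReal.ofReal (foldWeight fold k) * sqDist P (f.prelim k) τ := by
    refine sqDist_le_sum _ (fun k _ => foldWeight_nonneg fold k) (fun k _ => hf.prelim k)
      (fun _ _ => hτ) (Filter.Eventually.of_forall fun s => ?_)
    -- Jensen's inequality for the square; as the weights sum to one, `τ` can be subtracted inside
    -- the average.
    have hconv := (even_two.convexOn_pow (𝕜 := ℝ)).map_sum_le (t := Finset.univ)
      (w := foldWeight fold) (p := fun k => f.prelim k (xr s) - τ (xr s))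
      (fun k _ => foldWeight_nonneg fold k) hw (fun _ _ => Set.mem_univ _)
    simp only [smul_eq_mul, mul_sub, Finset.sum_sub_distrib, ← Finset.sum_mul, hw, one_mul]
      at hconv
    simpa [Fit.pooled] using hconv
  have h2 : ∀ k, sqDist P (f.prelim k) τ ≤ 2 * B := by
    intro k
    refine le_trans ?_ (mul_le_mul_right (hB k) 2)
    have := sqDist_le_sum (P := P) (f := f.prelim k) (g := τ) (Finset.univ : Finset Arm)
      (c := fun _ => 2) (u := f.armMean k) (v := mt) (fun _ _ => zero_le_two)
      (fun a _ => hf.armMean k a) (fun a _ => hmt a) (by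
        filter_upwards [hcontrast] with s hs
        simp only [hs, Fit.prelim, Fintype.sum_bool, sgn, if_true, Bool.false_eq_true, if_false]
        nlinarith [sq_nonneg ((f.armMean k true (xr s) - mt true (xr s)) +
          (f.armMean k false (xr s) - mt false (xr s)))])
    rw [Finset.mul_sum]
    simpa using this
  refine (h1.trans (Finset.sum_le_sum fun k _ => mul_le_mul_right (h2 k) _)).trans_eq ?_
  rw [← Finset.sum_mul, ← ENNReal.ofReal_sum_of_nonneg fun k _ => foldWeight_nonneg fold k, hw]
  simp

variable [IsProbabilityMeasure P]

/-- The population second-stage risk is, up to a constant, the squared distance of the aggregated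
estimator to the target CATE. -/
theorem exists_secondStageRisk_eq (hn : 0 < nr) (hv : InternalValidity P p)
    (hp : IsPropensity P p) (hY : ∀ a, MemLp (fun s => potential s a) 2 P)
    {τ : RctCov pu pz → ℝ} (hτ : IsCATE P τ) {f : Fit pu pz q} (hf : f.SquareIntegrable P)
    (fold : Fin nr → Fin q) :
    ∃ K : ℝ, ∀ d, MemLp d 2 (P.map xr) →
      0 ≤ K + ∫ s, (f.pooled fold (xr s) + d (xr s) - τ (xr s)) ^ 2 ∂P ∧
      secondStageRisk P p fold f d =
        ENNReal.ofReal (K + ∫ s, (f.pooled fold (xr s) + d (xr s) - τ (xr s)) ^ 2 ∂P) := by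
  have hψ : ∀ k, MemLp (pseudo p (f.cmo p k)) 2 P := fun k => memLp_pseudo hv hp hY (hf.cmo hv hp k)
  have hr : ∀ k, MemLp (fun s => f.prelim k (xr s)) 2 P := fun k => memLp_comp_xr (hf.prelim k)
  have hres : ∀ k, MemLp (fun s => pseudo p (f.cmo p k) s - f.prelim k (xr s)) 2 P :=
    fun k => (hψ k).sub (hr k)
  have hτP := memLp_comp_xr (hτ.memLp hY)
  have hpool := memLp_comp_xr (hf.pooled fold)
  have hdiff : MemLp (fun s => τ (xr s) - f.pooled fold (xr s)) 2 P := hτP.sub hpool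
  -- The constant comes from completing the square. Its sign is never examined: adding the squared
  -- distance gives the real-valued risk, which is nonnegative.
  refine ⟨∑ k, foldWeight fold k * ∫ s, (pseudo p (f.cmo p k) s - f.prelim k (xr s)) ^ 2 ∂P
    - ∫ s, (τ (xr s) - f.pooled fold (xr s)) ^ 2 ∂P, fun d hd => ?_⟩
  have hdP := memLp_comp_xr hd
  have hnn : 0 ≤ ∑ k, foldWeight fold k *
      ∫ s, (pseudo p (f.cmo p k) s - f.prelim k (xr s) - d (xr s)) ^ 2 ∂P :=
    Finset.sum_nonneg fun k _ => mul_nonneg (foldWeight_nonneg fold k)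
      (integral_nonneg fun _ => sq_nonneg _)
  have hrisk : secondStageRisk P p fold f d = ENNReal.ofReal (∑ k, foldWeight fold k *
      ∫ s, (pseudo p (f.cmo p k) s - f.prelim k (xr s) - d (xr s)) ^ 2 ∂P) := by
    rw [ENNReal.ofReal_sum_of_nonneg fun k _ => mul_nonneg (foldWeight_nonneg fold k)
      (integral_nonneg fun _ => sq_nonneg _)]
    refine Finset.sum_congr rfl fun k _ => ?_
    have hsub : MemLp (fun s => pseudo p (f.cmo p k) s - f.prelim k (xr s) - d (xr s)) 2 P :=
      (hres k).sub hdP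
    rw [ENNReal.ofReal_mul (foldWeight_nonneg fold k), ofReal_integral_eq_lintegral_ofReal
      hsub.integrable_sq (Filter.Eventually.of_forall fun _ => sq_nonneg _)]
    simp only [sub_sub]
  -- By unbiasedness, `d` sees the pseudo-outcome only through `τ`. The result is linear in the
  -- preliminary CATE, so the fold weights collect it into `pooled`.
  have hcross : ∀ k, ∫ s, (pseudo p (f.cmo p k) s - f.prelim k (xr s)) * d (xr s) ∂P =
      ∫ s, τ (xr s) * d (xr s) ∂P - ∫ s, f.prelim k (xr s) * d (xr s) ∂P := by
    intro k
    rw [← integral_pseudo_mul hv hp hY hτ (hf.cmo hv hp k) hd,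
      ← integral_sub (integrable_mul_of_memLp_two (hψ k) hdP) (integrable_mul_of_memLp_two (hr k) hdP)]
    congr 1; ext s; ring
  have hcross' : ∫ s, (τ (xr s) - f.pooled fold (xr s)) * d (xr s) ∂P =
      ∫ s, τ (xr s) * d (xr s) ∂P -
        ∑ k, foldWeight fold k * ∫ s, f.prelim k (xr s) * d (xr s) ∂P := by
    simp_rw [← integral_const_mul]
    rw [← integral_finsetSum _ fun k _ => (integrable_mul_of_memLp_two (hr k) hdP).const_mul _,
      ← integral_sub (integrable_mul_of_memLp_two hτP hdP)
        (integrable_finsetSum _ fun k _ => (integrable_mul_of_memLp_two (hr k) hdP).const_mul _)]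
    congr 1; ext s
    simp only [Fit.pooled, sub_mul, Finset.sum_mul, mul_assoc]
  have hsq : ∫ s, (f.pooled fold (xr s) + d (xr s) - τ (xr s)) ^ 2 ∂P =
      ∫ s, (τ (xr s) - f.pooled fold (xr s) - d (xr s)) ^ 2 ∂P := by
    congr 1; ext s; ring
  have heq : ∑ k, foldWeight fold k *
      ∫ s, (pseudo p (f.cmo p k) s - f.prelim k (xr s) - d (xr s)) ^ 2 ∂P =
      ∑ k, foldWeight fold k * ∫ s, (pseudo p (f.cmo p k) s - f.prelim k (xr s)) ^ 2 ∂P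
      - ∫ s, (τ (xr s) - f.pooled fold (xr s)) ^ 2 ∂P
      + ∫ s, (f.pooled fold (xr s) + d (xr s) - τ (xr s)) ^ 2 ∂P := by
    rw [hsq, integral_sub_sq hdiff hdP, hcross']
    have : ∀ k, foldWeight fold k *
        ∫ s, (pseudo p (f.cmo p k) s - f.prelim k (xr s) - d (xr s)) ^ 2 ∂P =
        foldWeight fold k * ∫ s, (pseudo p (f.cmo p k) s - f.prelim k (xr s)) ^ 2 ∂P
        + 2 * (foldWeight fold k * ∫ s, f.prelim k (xr s) * d (xr s) ∂P)
        + foldWeight fold k * (∫ s, d (xr s) ^ 2 ∂P - 2 * ∫ s, τ (xr s) * d (xr s) ∂P) := by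
      intro k
      rw [integral_sub_sq (hres k) hdP, hcross]
      ring
    simp_rw [this]
    rw [Finset.sum_add_distrib, Finset.sum_add_distrib, ← Finset.sum_mul, ← Finset.mul_sum,
      sum_foldWeight hn]
    ring
  rw [← heq]
  exact ⟨hnn, hrisk⟩

/-- A near-minimizer of the second-stage risk does not worsen the aggregated preliminary CATE. -/
theorem sqDist_pooled_add_le (hn : 0 < nr) (hv : InternalValidity P p)
    (hp : IsPropensity P p) (hY : ∀ a, MemLp (fun s => potential s a) 2 P)
    {τ : RctCov pu pz → ℝ} (hτ : IsCATE P τ) {f : Fit pu pz q} (hf : f.SquareIntegrable P)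
    {fold : Fin nr → Fin q} {d : RctCov pu pz → ℝ} (hd : MemLp d 2 (P.map xr)) {e : ℝ}
    (he : 0 ≤ e) (hle : secondStageRisk P p fold f d ≤
      secondStageRisk P p fold f 0 + ENNReal.ofReal e) :
    sqDist P (fun x => f.pooled fold x + d x) τ ≤
      sqDist P (f.pooled fold) τ + ENNReal.ofReal e := by
  obtain ⟨K, hK⟩ := exists_secondStageRisk_eq hn hv hp hY hτ hf fold
  obtain ⟨h0, e0⟩ := hK 0 MemLp.zero
  obtain ⟨-, e1⟩ := hK d hd
  -- Nonnegativity lets the comparison descend to the reals, where the common constant `K` cancels.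
  rw [e0, e1, ← ENNReal.ofReal_add h0 he, ENNReal.ofReal_le_ofReal_iff (add_nonneg h0 he)] at hle
  simp only [Pi.zero_apply, add_zero] at hle
  have hτL := hτ.memLp hY
  rw [sqDist_eq_ofReal_integral (f := fun x => f.pooled fold x + d x)
      ((hf.pooled fold).add hd) hτL,
    sqDist_eq_ofReal_integral (hf.pooled fold) hτL,
    ← ENNReal.ofReal_add (integral_nonneg fun _ => sq_nonneg _) he]
  exact ENNReal.ofReal_le_ofReal (by simpa [add_assoc] using hle)

end

/-! ### The deterministic bound on the event of accurate fits -/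

variable {pu pz pv nr no q : ℕ} {P : Measure (Subject pu pz pv)}
  {p : Arm → RctCov pu pz → ℝ} {H : Classes pu pz} {foldR : Fin nr → Fin q}
  {mS : Arm → EuclideanSpace ℝ (Fin pz) → ℝ} {dS : Arm → RctCov pu pz → ℝ}
  {κ e t : ℝ≥0∞} {w : Data pu pz pv nr no} {f : Fit pu pz q}

/-- The error of an arm-wise prediction: estimation errors of both steps and the oracle error. -/
theorem Accurate.sqDist_armMean_le (h : Accurate P H p foldR mS dS κ e t w f)
    (hf : f.SquareIntegrable P) {a : Arm} (hmS : MemLp (mS a) 2 (P.map shared))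
    (hdS : MemLp (dS a) 2 (P.map xr)) {mt : RctCov pu pz → ℝ} (hmt : MemLp mt 2 (P.map xr))
    (k : Fin q) :
    sqDist P (f.armMean k a) mt ≤
      4 * (κ * (rademacher (H.osClass a) (fun i => shared (w.2 i)) ^ 2 + t)
        + κ * (rademacher (H.discClass a) (fun i => xr (w.1 i)) ^ 2 + t))
      + 2 * sqDist P (fun x => mS a x.2 + dS a x) mt := by
  have hsum : MemLp (fun x : RctCov pu pz => mS a x.2 + dS a x) 2 (P.map xr) :=
    (memLp_comp_shared hmS).add hdS
  have h1 := sqDist_le_two_mul_add (hf.armMean k a) hsum hsum hmt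
    (f := f.armMean k a) (g := mt) (fun x => by ring)
  have h2 := sqDist_le_two_mul_add (memLp_comp_shared (hf.os k a)) (memLp_comp_shared hmS)
    (hf.disc k a) hdS (f := f.armMean k a) (g := fun x => mS a x.2 + dS a x)
    (fun x => by simp only [Fit.armMean]; ring)
  calc sqDist P (f.armMean k a) mt
      ≤ 2 * (2 * (sqDist P (fun x => f.os k a x.2) (fun x => mS a x.2)
          + sqDist P (f.disc k a) (dS a)) + sqDist P (fun x => mS a x.2 + dS a x) mt) :=
        h1.trans (by gcongr)
    _ ≤ 2 * (2 * (κ * (rademacher (H.osClass a) (fun i => shared (w.2 i)) ^ 2 + t)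
          + κ * (rademacher (H.discClass a) (fun i => xr (w.1 i)) ^ 2 + t))
          + sqDist P (fun x => mS a x.2 + dS a x) mt) := by
        gcongr
        · exact h.os_le k a
        · exact h.disc_le k a
    _ = _ := by ring

/-- On the event of accurate fits, the estimator obeys the risk bound. -/
theorem Accurate.sqDist_tauHat_le [IsProbabilityMeasure P] (hn : 0 < nr)
    (hv : InternalValidity P p) (hp : IsPropensity P p)
    (hY : ∀ a, MemLp (fun s => potential s a) 2 P)
    {τ : RctCov pu pz → ℝ} (hτ : IsCATE P τ)
    {m : Arm → FullCov pu pz pv → ℝ} (hm : IsArmMean P m)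
    {mt : Arm → RctCov pu pz → ℝ} (hmt : IsMarginalArmMean P m mt)
    (hos : ∀ a, ∀ m ∈ H.osClass a, MemLp m 2 (P.map shared))
    (hdisc : ∀ a, ∀ d ∈ H.discClass a, MemLp d 2 (P.map xr))
    (hcate : ∀ d ∈ H.cateClass, MemLp d 2 (P.map xr)) (hzero : 0 ∈ H.cateClass)
    (hfos : ∀ k a, f.os k a ∈ H.osClass a) (hfdisc : ∀ k a, f.disc k a ∈ H.discClass a)
    (hfcate : f.cate ∈ H.cateClass)
    (horacle : ∀ a, mS a ∈ H.osClass a ∧ dS a ∈ H.discClass a ∧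
      sqDist P (fun x => mS a x.2 + dS a x) (mt a) ≤
        approxError P (H.representable a) (mt a) + t)
    (ht : t ≠ ∞) (h : Accurate P H p foldR mS dS κ t t w f) :
    sqDist P (f.tauHat foldR) τ ≤
      (66 * κ + 18) * (mismatch P H mt + rademacher H.cateClass (fun i => xr (w.1 i)) ^ 2
        + ∑ a, (rademacher (H.osClass a) (fun i => shared (w.2 i)) ^ 2
            + rademacher (H.discClass a) (fun i => xr (w.1 i)) ^ 2))
      + (66 * κ + 18) * t := by
  have hf : f.SquareIntegrable P :=
    ⟨fun k a => hos a _ (hfos k a), fun k a => hdisc a _ (hfdisc k a)⟩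
  have hmtL := hmt.memLp hv hp hY hm
  set M := mismatch P H mt with hM
  set R := rademacher H.cateClass (fun i => xr (w.1 i)) ^ 2
  set S := ∑ a, (rademacher (H.osClass a) (fun i => shared (w.2 i)) ^ 2
    + rademacher (H.discClass a) (fun i => xr (w.1 i)) ^ 2) with hS
  -- Each arm contributes `8 * κ * t` from its two rates and `2 * t` from the oracle slack; the
  -- coefficient of `t` doubles over the arms.
  have hB : ∀ k, ∑ a, sqDist P (f.armMean k a) (mt a) ≤ 4 * κ * S + 2 * M + (16 * κ + 4) * t := by
    intro k
    calc ∑ a, sqDist P (f.armMean k a) (mt a)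
        ≤ ∑ a, (4 * (κ * (rademacher (H.osClass a) (fun i => shared (w.2 i)) ^ 2 + t)
            + κ * (rademacher (H.discClass a) (fun i => xr (w.1 i)) ^ 2 + t))
            + 2 * (approxError P (H.representable a) (mt a) + t)) := by
          refine Finset.sum_le_sum fun a _ => ?_
          obtain ⟨h1, h2, h3⟩ := horacle a
          exact (h.sqDist_armMean_le hf (hos a _ h1) (hdisc a _ h2) (hmtL a) k).trans (by gcongr)
      _ = _ := by
          simp only [hS, hM, mismatch, Fintype.sum_bool]
          ring
  have hpool := sqDist_pooled_le hn hf foldR (hτ.memLp hY) hmtL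
    (hτ.ae_eq_contrast hv hp hY hm hmt) hB
  obtain ⟨d, hd, hdmin, hdist⟩ := h.cate_le
  have hdL := hcate d hd
  -- The competitor is the zero correction, so the near-minimizer inherits the error of the
  -- preliminary CATE.
  have hnear : sqDist P (fun x => f.pooled foldR x + d x) τ ≤ sqDist P (f.pooled foldR) τ + t := by
    rw [← ENNReal.ofReal_toReal ht]
    refine sqDist_pooled_add_le hn hv hp hY hτ hf hdL ENNReal.toReal_nonneg ?_
    rw [ENNReal.ofReal_toReal ht]
    exact hdmin 0 hzero
  have hsplit := sqDist_le_two_mul_add (hcate _ hfcate) hdL ((hf.pooled foldR).add hdL)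
    (hτ.memLp hY) (f := f.tauHat foldR) (g := τ)
    (fun x => by simp only [Fit.tauHat, Fit.pooled, Pi.add_apply]; ring)
  calc sqDist P (f.tauHat foldR) τ
      ≤ 2 * (sqDist P f.cate d + sqDist P (fun x => f.pooled foldR x + d x) τ) := hsplit
    _ ≤ 2 * (κ * (R + t) + (2 * (4 * κ * S + 2 * M + (16 * κ + 4) * t) + t)) := by
        gcongr
        exact hnear.trans (by gcongr)
    -- The coefficient of `t` is already `66 * κ + 18`, the largest of all; the added terms raise
    -- those of `M`, `R` and `S` to it, so that `ring` can close with one common constant.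
    _ ≤ 2 * (κ * (R + t) + (2 * (4 * κ * S + 2 * M + (16 * κ + 4) * t) + t))
        + ((66 * κ + 10) * M + (64 * κ + 18) * R + (50 * κ + 18) * S) := le_self_add
    _ = _ := by ring

end SROscar

end

/-! ### From the deterministic bound to high probability -/

theorem mainTheorem5 (κ : ℝ) (hκ : 0 < κ) :
    ∃ C : ℝ, 0 < C ∧
      ∀ (pu pz pv nr no q : ℕ) (_ : 0 < nr) (_ : 0 < no) (_ : 2 ≤ q)
        (Pr Po : MeasureTheory.Measure (SROscar.Subject pu pz pv))
        [MeasureTheory.IsProbabilityMeasure Pr] [MeasureTheory.IsProbabilityMeasure Po]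
        -- square-integrable outcomes
        (_ : ∀ a, MeasureTheory.MemLp (fun s => SROscar.potential s a) 2 Pr)
        (_ : MeasureTheory.MemLp SROscar.outcome 2 Po)
        -- propensity, target CATE, full and marginalized arm means
        (p : SROscar.Arm → SROscar.RctCov pu pz → ℝ) (_ : SROscar.IsPropensity Pr p)
        (τ : SROscar.RctCov pu pz → ℝ) (_ : SROscar.IsCATE Pr τ)
        (μr μo : SROscar.Arm → SROscar.FullCov pu pz pv → ℝ)
        (_ : SROscar.IsArmMean Pr μr) (_ : SROscar.IsArmMean Po μo)
        (μt : SROscar.Arm → SROscar.RctCov pu pz → ℝ)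
        (_ : SROscar.IsMarginalArmMean Pr μr μt)
        -- internal validity
        (_ : SROscar.InternalValidity Pr p)
        -- outcome shift
        (δ : SROscar.Arm → SROscar.FullCov pu pz pv → ℝ)
        (_ : ∀ a x, μr a x = μo a x + δ a x)
        (shiftClass : SROscar.Arm → Set (SROscar.FullCov pu pz pv → ℝ))
        (_ : ∀ a, δ a ∈ shiftClass a)
        (_ : ∀ a, ∀ᵐ w ∂(SROscar.dataLaw Pr Po nr no),
          SROscar.rademacher (shiftClass a) (fun i => SROscar.full (w.1 i)) < ⊤)
        -- Lipschitz dependence on the OS-only block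
        (L : ℝ) (_ : 0 < L)
        (_ : ∀ a x v v', |μr a (x, v) - μr a (x, v')| ≤ L * ‖v - v'‖)
        (_ : ∀ a x v v', |μo a (x, v) - μo a (x, v')| ≤ L * ‖v - v'‖)
        (_ : ∀ a x v v', |δ a (x, v) - δ a (x, v')| ≤ L * ‖v - v'‖)
        -- square-integrable function classes, the correction class containing zero
        (H : SROscar.Classes pu pz)
        (_ : ∀ a, ∀ m ∈ H.osClass a, MeasureTheory.MemLp m 2 (Pr.map SROscar.shared))
        (_ : ∀ a, ∀ d ∈ H.discClass a, MeasureTheory.MemLp d 2 (Pr.map SROscar.xr))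
        (_ : ∀ d ∈ H.cateClass, MeasureTheory.MemLp d 2 (Pr.map SROscar.xr))
        (_ : (0 : SROscar.RctCov pu pz → ℝ) ∈ H.cateClass)
        -- cross-fitted penalized empirical risk minimization with rates
        (pen : SROscar.Penalties pu pz) (foldR : Fin nr → Fin q) (foldO : Fin no → Fin q)
        (F : SROscar.Data pu pz pv nr no → SROscar.Fit pu pz q)
        (_ : ∀ᵐ w ∂(SROscar.dataLaw Pr Po nr no),
          SROscar.IsFit H pen p foldR foldO w (F w))
        (_ : SROscar.Rates Pr Po H p μt foldR κ F)
        (γ : ℝ) (_ : 0 < γ) (_ : γ < 1),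
        SROscar.dataLaw Pr Po nr no
          {w | ¬ SROscar.sqDist Pr ((F w).tauHat foldR) τ ≤
            SROscar.riskBound Pr H τ μt C γ w} ≤ ENNReal.ofReal γ := by
  refine ⟨66 * κ + 18, by positivity, ?_⟩
  intro pu pz pv nr no q hn _ _ Pr Po _ _ hY _ p hp τ hτ μr μo hμr _ μt hμt hv _ _ _ _ _ _ _ _ _ _
    H hos hdisc hcate hzero pen foldR foldO F hfit hrates γ hγ0 hγ1
  have hlog : 0 < Real.log (1 / γ) / nr :=
    div_pos (Real.log_pos (by rw [one_div]; exact (one_lt_inv₀ hγ0).2 hγ1)) (Nat.cast_pos.2 hn)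
  -- The tolerance is chosen equal to the deviation term, positive because `γ < 1`, so every
  -- near-minimization slack is absorbed into it. The oracles may thus depend on `γ`.
  obtain ⟨mS, dS, horacle, hacc⟩ :=
    hrates (ENNReal.ofReal (Real.log (1 / γ) / nr)) (ENNReal.ofReal_pos.2 hlog)
  refine le_trans (MeasureTheory.measure_mono_ae ?_) (hacc γ hγ0 hγ1)
  filter_upwards [hfit] with w hw hbad
  refine fun h => hbad ?_
  have hC : ENNReal.ofReal (66 * κ + 18) = 66 * ENNReal.ofReal κ + 18 := by
    rw [ENNReal.ofReal_add (by positivity) (by norm_num), ENNReal.ofReal_mul (by norm_num)]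
    norm_num
  have := h.sqDist_tauHat_le hn hv hp hY hτ hμr hμt hos hdisc hcate hzero hw.os_mem hw.disc_mem
    hw.cate_mem horacle ENNReal.ofReal_ne_top
  refine this.trans ?_
  rw [SROscar.riskBound, mul_div_assoc, ENNReal.ofReal_mul (by positivity), hC]
  -- The approximation error of the correction class is added here as a nonnegative term.
  exact le_add_self.trans_eq (add_assoc _ _ _).symm
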